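/- \textbf{Setting.} Let $C\subset\mathbb R^n$ be closed and convex, $f:\mathbb R^n\to\mathbb R$ essentially smooth (locally Lipschitz, and strictly differentiable at Lebesgue-almost every point), let $N$ be any norm on $\mathbb R^n$ (the trust-region norm), and let $x^1\in C$ be such that $\{x\in C: f(x)\le f(x^1)\}$ is bounded. Write $f^\circ(x,d)$ for the Clarke directional derivative, $\partial f$ for the Clarke subdifferential, $N_C(x)$ for the normal cone; $x\in C$ is \emph{critical} if $0\in\partial f(x)+N_C(x)$. The \emph{standard model} is $\phi^\sharp(y,x)=f(x)+f^\circ(x,y-x)$. It is \emph{strict} at $x$ if for all $y_k\to x$, $x_k\to x$ there are $\epsilon_k\to0^+$ with $f(y_k)\le\phi^\sharp(y_k,x_k)+\epsilon_k\|y_k-x_k\|$. Fix $0<\gamma<\widetilde\gamma<1$, $\gamma<\Gamma\le1$, $0<\theta<1$, $M\ge1$. \textbf{Bundle trust-region algorithm (Algorithm 1) with model $\phi^\sharp$.} Start at $x^1$ with memory radius $R_1^\sharp>0$. Stop if the serious iterate $x=x^j$ is critical. Otherwise put $R_1=R_j^\sharp$ and for $k=1,2,\dots$ do the following. Take a working model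 $\phi_k(y)=\sup_{(a,g)\in\mathcal G_k}a+g^\top(y-x)$, where $\mathcal G_k$ is a set of cutting planes, that is, of pairs $(a,g)$ with $g\in\partial_1\phi^\sharp(z,x)$, $a=\phi^\sharp(z,x)+g^\top(x-z)$ for some $z$, and contains at least one pair $(f(x),g_0)$ with $g_0\in\partial f(x)$. Let $y^k$ minimize $\phi_k$ over $\{y\in C: N(y-x)\le R_k\}$, and choose a trial step $z^k\in C$ with $N(z^k-x)\le M\,N(x-y^k)$ and $f(x)-\phi_k(z^k)\ge\theta(f(x)-\phi_k(y^k))$. Let $\rho_k=\frac{f(x)-f(z^k)}{f(x)-\phi_k(z^k)}$. If $\rho_k\ge\gamma$, put $x^{j+1}=z^k$ and $R_{j+1}^\sharp=R_k$ if $\rho_k<\Gamma$, $R_{j+1}^\sharp=2R_k$ if $\rho_k\ge\Gamma$, and go to outer iteration $j+1$. Otherwise (null step) a cutting plane at $z^k$ is included in $\mathcal G_{k+1}$ (other planes may be added or removed), and $R_{k+1}=\frac12R_k$ if $\frac{f(x)-\phi^\sharp(z^k,x)}{f(x)-\phi_k(z^k)}\ge\widetilde\gamma$, $R_{k+1}=R_k$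 otherwise. \textbf{Classical trust-region algorithm.} The same scheme, with $f$ differentiable at the serious iterates, with the first-order Taylor polynomial $f(x)+\nabla f(x)^\top(\cdot-x)$ in place of $\phi_k$, stopping when $-\nabla f(x)\in N_C(x)$, and with $R_{k+1}=\frac12R_k$ after every null step. \textbf{Proposition.} (1) Let $w_1,w_2,\dots$ be independent random points with common law $\mu$, where $\mu$ is a probability measure with $\mu(C)=1$ that is absolutely continuous with respect to Lebesgue measure on $\mathbb R^n$, and let the trial steps of a run be taken successively, without reuse, from this sequence (draws, such as those which are not valid trial steps, may be discarded). Then with probability one the following holds, whatever the remaining choices in the algorithm. In every run of the bundle trust-region algorithm with model $\phi^\sharp$ started at $x^1$, all outer iterations $j\ge2$ are outer iterations of the classical trust-region algorithm. If moreover $f$ is strictly differentiable at $x^1$, then a record of serious iterates, radii, tangent solutions, trial steps and acceptance decisions is that of a run of the bundle algorithm started at $x^1$ if and only if it is that of a run of the classical algorithm started at $x^1$. (2) If $\phi^\sharp$ is strict at every point of $C$, then for every run of the bundle trust-region algorithm with model $\phi^\sharp$ started at $x^1$ that generates an infinite sequence $x^j$ of serious iterates, every accumulation point of this sequence is critical.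 -/

import Mathlib

open Filter Topology MeasureTheory ProbabilityTheory
open scoped RealInnerProductSpace

namespace BundleTR

/-- The space `ℝⁿ`. -/
abbrev Space (n : ℕ) := EuclideanSpace ℝ (Fin n)

/-! ### Clarke calculus -/

/-- The Clarke directional derivative
`f°(x, d) = limsup_{x' → x, t ↓ 0} (f (x' + t d) - f x') / t`. -/
noncomputable def clarkeDeriv {n : ℕ} (f : Space n → ℝ) (x d : Space n) : ℝ :=
  limsup (fun p : Space n × ℝ => (f (p.1 + p.2 • d) - f p.1) / p.2) (𝓝 x ×ˢ 𝓝[>] (0 : ℝ))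

/-- The Clarke subdifferential `∂f(x)`. -/
def clarkeSubdiff {n : ℕ} (f : Space n → ℝ) (x : Space n) : Set (Space n) :=
  {g | ∀ d, ⟪g, d⟫ ≤ clarkeDeriv f x d}

/-- The normal cone to the convex set `C` at `x`. -/
def normalCone {n : ℕ} (C : Set (Space n)) (x : Space n) : Set (Space n) :=
  {q | ∀ y ∈ C, ⟪q, y - x⟫ ≤ 0}

/-- `x` is a critical point of the program `min {f x : x ∈ C}`: `x ∈ C` and
`0 ∈ ∂f(x) + N_C(x)`. -/
def IsCritical {n : ℕ} (f : Space n → ℝ) (C : Set (Space n)) (x : Space n) : Prop :=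
  x ∈ C ∧ ∃ p ∈ clarkeSubdiff f x, ∃ q ∈ normalCone C x, p + q = 0

/-- `f` is strictly differentiable at `x`. -/
def StrictlyDifferentiableAt {n : ℕ} (f : Space n → ℝ) (x : Space n) : Prop :=
  ∃ f' : Space n →L[ℝ] ℝ, HasStrictFDerivAt f f' x

/-- `f` is essentially smooth: locally Lipschitz, and strictly differentiable at Lebesgue almost
every point. -/
def EssentiallySmooth {n : ℕ} (f : Space n → ℝ) : Prop :=
  LocallyLipschitz f ∧ ∀ᵐ x, StrictlyDifferentiableAt f x

/-! ### Models -/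

/-- The standard model `φ♯(y, x) = f(x) + f°(x, y - x)` of `f`. -/
noncomputable def standardModel {n : ℕ} (f : Space n → ℝ) (y x : Space n) : ℝ :=
  f x + clarkeDeriv f x (y - x)

/-- The model `φ` of `f` is strict at `x`: whenever `y_k → x` and `x_k → x`, there are
`ε_k → 0⁺` with `f(y_k) ≤ φ(y_k, x_k) + ε_k ‖y_k - x_k‖`. -/
def IsStrictModelAt {n : ℕ} (f : Space n → ℝ) (φ : Space n → Space n → ℝ) (x : Space n) : Prop :=
  ∀ u v : ℕ → Space n, Tendsto u atTop (𝓝 x) → Tendsto v atTop (𝓝 x) →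
    ∃ ε : ℕ → ℝ, (∀ k, 0 < ε k) ∧ Tendsto ε atTop (𝓝 0) ∧
      ∀ k, f (u k) ≤ φ (u k) (v k) + ε k * ‖u k - v k‖

/-- The pair `(a, g)` represents the cutting plane `a + ⟪g, · - x⟫` of `φ(·, x)` drawn at `z`:
`g ∈ ∂₁φ(z, x)` and `a = φ(z, x) + ⟪g, x - z⟫`. -/
def IsCutAt {n : ℕ} (φ : Space n → Space n → ℝ) (x z : Space n) (p : ℝ × Space n) : Prop :=
  p.2 ∈ clarkeSubdiff (fun y => φ y x) z ∧ p.1 = φ z x + ⟪p.2, x - z⟫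

/-- `G` is a set of cutting planes at the serious iterate `x` that contains at least one
exactness plane `(f(x), g₀)`, `g₀ ∈ ∂f(x)`. -/
def IsWorkingSet {n : ℕ} (f : Space n → ℝ) (φ : Space n → Space n → ℝ) (x : Space n)
    (G : Set (ℝ × Space n)) : Prop :=
  (∀ p ∈ G, ∃ z, IsCutAt φ x z p) ∧ ∃ g₀ ∈ clarkeSubdiff f x, (f x, g₀) ∈ G

/-- The working model `y ↦ max_{(a, g) ∈ G} a + ⟪g, y - x⟫` built from `G`. -/
noncomputable def workingModel {n : ℕ} (G : Set (ℝ × Space n)) (x y : Space n) : ℝ :=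
  ⨆ p : G, (p.1.1 + ⟪p.1.2, y - x⟫)

/-- The first-order Taylor polynomial of `f` at `x`. -/
noncomputable def taylorModel {n : ℕ} (f : Space n → ℝ) (x y : Space n) : ℝ :=
  f x + ⟪gradient f x, y - x⟫

/-! ### The algorithms -/

/-- The parameters of the trust-region algorithms. -/
structure Params where
  γ : ℝ
  γt : ℝ
  Γ : ℝ
  θ : ℝ
  M : ℝ
  γ_pos : 0 < γ
  γ_lt_γt : γ < γt
  γt_lt_one : γt < 1
  γ_lt_Γ : γ < Γ
  Γ_le_one : Γ ≤ 1
  θ_pos : 0 < θ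
  θ_lt_one : θ < 1
  one_le_M : 1 ≤ M

/-- The problem data: the objective `f`, the constraint set `C`, and the function `N` whose value
`N v` is the trust-region norm of `v`. -/
structure Problem (n : ℕ) where
  f : Space n → ℝ
  C : Set (Space n)
  closed : IsClosed C
  convex : Convex ℝ C
  N : Seminorm ℝ (Space n)
  definite : ∀ v, N v = 0 → v = 0

/-- The record of a run of a trust-region algorithm. Both the outer counter `j` and the inner
counter `k` start at `0`. `executed j k` says that step `k` of inner loop `j` is carried out,
`accepted j k` that its trial step is accepted. Entries that belong to steps which are not carried
out have no meaning. -/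
structure Trace (n : ℕ) where
  /-- serious iterates -/
  x : ℕ → Space n
  /-- memory trust-region radii -/
  Rmem : ℕ → ℝ
  /-- trust-region radii -/
  R : ℕ → ℕ → ℝ
  /-- solutions of the tangent programs -/
  y : ℕ → ℕ → Space n
  /-- trial steps -/
  z : ℕ → ℕ → Space n
  executed : ℕ → ℕ → Prop
  accepted : ℕ → ℕ → Prop

/-- The serious iterate `x j` is generated: every earlier inner loop ends with a serious step. -/
def Trace.Reached {n : ℕ} (T : Trace n) (j : ℕ) : Prop :=
  ∀ i < j, ∃ k, T.executed i k ∧ T.accepted i k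

/-- `y` solves the tangent program: minimize `m` over `C ∩ {y | N (y - x) ≤ R}`. -/
def IsTangentSolution {n : ℕ} (Q : Problem n) (m : Space n → ℝ) (x : Space n) (R : ℝ)
    (y : Space n) : Prop :=
  (y ∈ Q.C ∧ Q.N (y - x) ≤ R) ∧ ∀ y' ∈ Q.C, Q.N (y' - x) ≤ R → m y ≤ m y'

/-- `z` is a trial step at `x`, for the model `m` and the tangent solution `y`. -/
def IsTrialStep {n : ℕ} (P : Params) (Q : Problem n) (m : Space n → ℝ) (x y z : Space n) : Prop :=
  z ∈ Q.C ∧ Q.N (z - x) ≤ P.M * Q.N (x - y) ∧ P.θ * (Q.f x - m y) ≤ Q.f x - m z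

/-- The test quotient `(f(x) - f(z)) / (f(x) - m(z))`. -/
noncomputable def testQuotient {n : ℕ} (f m : Space n → ℝ) (x z : Space n) : ℝ :=
  (f x - f z) / (f x - m z)

/-- Outer iteration `j` of a trust-region algorithm which stops when `halt` holds at the serious
iterate, uses the model `m k` in step `k` of the inner loop, and after a null step `k` halves the
radius exactly when `shrink k` holds. -/
structure IsLoop {n : ℕ} (P : Params) (Q : Problem n) (T : Trace n) (j : ℕ) (halt : Prop)
    (m : ℕ → Space n → ℝ) (shrink : ℕ → Prop) : Prop where
  /-- stopping test -/
  enter : T.executed j 0 ↔ T.Reached j ∧ ¬ halt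
  /-- the inner loop goes on exactly after null steps -/
  next : ∀ k, T.executed j (k + 1) ↔ T.executed j k ∧ ¬ T.accepted j k
  /-- the inner loop starts with the memory radius -/
  init : T.executed j 0 → T.R j 0 = T.Rmem j
  /-- tangent program -/
  tangent : ∀ k, T.executed j k → IsTangentSolution Q (m k) (T.x j) (T.R j k) (T.y j k)
  /-- trial step generation -/
  trial : ∀ k, T.executed j k → IsTrialStep P Q (m k) (T.x j) (T.y j k) (T.z j k)
  /-- acceptance test -/
  accept : ∀ k, T.executed j k →
    (T.accepted j k ↔ P.γ ≤ testQuotient Q.f (m k) (T.x j) (T.z j k))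
  /-- serious step -/
  serious : ∀ k, T.executed j k → T.accepted j k → T.x (j + 1) = T.z j k
  /-- update of the memory radius -/
  memory_keep : ∀ k, T.executed j k → T.accepted j k →
    testQuotient Q.f (m k) (T.x j) (T.z j k) < P.Γ → T.Rmem (j + 1) = T.R j k
  memory_double : ∀ k, T.executed j k → T.accepted j k →
    P.Γ ≤ testQuotient Q.f (m k) (T.x j) (T.z j k) → T.Rmem (j + 1) = 2 * T.R j k
  /-- update of the trust-region radius after a null step -/
  radius_keep : ∀ k, T.executed j k → ¬ T.accepted j k → ¬ shrink k →
    T.R j (k + 1) = T.R j k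
  radius_halve : ∀ k, T.executed j k → ¬ T.accepted j k → shrink k →
    T.R j (k + 1) = T.R j k / 2

/-- Outer iteration `j` of the bundle trust-region algorithm based on the model `φ`, with working
sets `G k`. After a null step a cutting plane at the trial step enters the next working set.
Apart from this, and from the presence of an exactness plane, planes may be added, recycled and
removed freely. -/
structure IsBundleLoop {n : ℕ} (P : Params) (Q : Problem n) (φ : Space n → Space n → ℝ)
    (T : Trace n) (j : ℕ) (G : ℕ → Set (ℝ × Space n)) : Prop where
  working : ∀ k, T.executed j k → IsWorkingSet Q.f φ (T.x j) (G k)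
  cut : ∀ k, T.executed j k → ¬ T.accepted j k →
    ∃ p ∈ G (k + 1), IsCutAt φ (T.x j) (T.z j k) p
  /-- the radius is halved exactly when the secondary quotient
  `(f(x) - φ(z, x)) / (f(x) - φ_k(z, x))` is at least `γt` -/
  loop : IsLoop P Q T j (IsCritical Q.f Q.C (T.x j)) (fun k => workingModel (G k) (T.x j))
    (fun k => P.γt ≤ (Q.f (T.x j) - φ (T.z j k) (T.x j)) /
      (Q.f (T.x j) - workingModel (G k) (T.x j) (T.z j k)))

/-- `T` is a run, started at `x₁`, of the bundle trust-region algorithm based on the model `φ`. -/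
def IsBundleRun {n : ℕ} (P : Params) (Q : Problem n) (φ : Space n → Space n → ℝ)
    (x₁ : Space n) (T : Trace n) : Prop :=
  T.x 0 = x₁ ∧ 0 < T.Rmem 0 ∧
    ∃ G : ℕ → ℕ → Set (ℝ × Space n), ∀ j, IsBundleLoop P Q φ T j (G j)

/-- Outer iteration `j` of the classical trust-region algorithm: `f` is differentiable at the
serious iterate, the model is the first-order Taylor polynomial, the algorithm stops when
`-∇f(x) ∈ N_C(x)`, and the radius is halved after every null step. -/
structure IsClassicalLoop {n : ℕ} (P : Params) (Q : Problem n) (T : Trace n) (j : ℕ) : Prop where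
  differentiable : T.Reached j → DifferentiableAt ℝ Q.f (T.x j)
  loop : IsLoop P Q T j (-gradient Q.f (T.x j) ∈ normalCone Q.C (T.x j))
    (fun _ => taylorModel Q.f (T.x j)) (fun _ => True)

/-- `T` is a run, started at `x₁`, of the classical trust-region algorithm. -/
def IsClassicalRun {n : ℕ} (P : Params) (Q : Problem n) (x₁ : Space n) (T : Trace n) : Prop :=
  T.x 0 = x₁ ∧ 0 < T.Rmem 0 ∧ ∀ j, IsClassicalLoop P Q T j

/-- The trial steps of `T` are taken, in the order of the run and without reuse, from the sequence
of draws `w`; draws may be discarded, for instance those that are not valid trial steps. -/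
def Trace.DrawnFrom {n : ℕ} (T : Trace n) (w : ℕ → Space n) : Prop :=
  ∃ idx : ℕ → ℕ → ℕ, (∀ j k, T.executed j k → T.z j k = w (idx j k)) ∧
    ∀ j k j' k', T.executed j k → T.executed j' k' →
      (j < j' ∨ (j = j' ∧ k < k')) → idx j k < idx j' k'

end BundleTR

namespace BundleTR

variable {n : ℕ} {f : Space n → ℝ} {x d : Space n}

/-! ### The Clarke directional derivative of a locally Lipschitz function -/

/-- The filter of base points `x' → x` and step sizes `t ↓ 0`. -/
def clarkeFilter (x : Space n) : Filter (Space n × ℝ) := 𝓝 x ×ˢ 𝓝[>] (0 : ℝ)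

instance (x : Space n) : (clarkeFilter x).NeBot := by
  unfold clarkeFilter; infer_instance

/-- The difference quotient of `f` in direction `d`. -/
noncomputable def diffQuotient (f : Space n → ℝ) (d : Space n) (p : Space n × ℝ) : ℝ :=
  (f (p.1 + p.2 • d) - f p.1) / p.2

theorem tendsto_fst_clarkeFilter (x : Space n) : Tendsto Prod.fst (clarkeFilter x) (𝓝 x) :=
  tendsto_fst

theorem tendsto_snd_clarkeFilter (x : Space n) :
    Tendsto Prod.snd (clarkeFilter x) (𝓝[>] (0 : ℝ)) :=
  tendsto_snd

theorem eventually_snd_pos (x : Space n) : ∀ᶠ p in clarkeFilter x, 0 < p.2 :=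
  (tendsto_snd_clarkeFilter x).eventually self_mem_nhdsWithin

theorem tendsto_add_smul_clarkeFilter (x d : Space n) :
    Tendsto (fun p : Space n × ℝ => p.1 + p.2 • d) (clarkeFilter x) (𝓝 x) := by
  have h := (tendsto_fst_clarkeFilter x).add
    (((tendsto_snd_clarkeFilter x).mono_right nhdsWithin_le_nhds).smul_const d)
  simpa using h

theorem exists_bound_diffQuotient (hf : LocallyLipschitz f) (x : Space n) :
    ∃ K : ℝ, 0 ≤ K ∧ ∀ᶠ x' in 𝓝 x, ∀ d, ∀ᶠ p in clarkeFilter x', |diffQuotient f d p| ≤ K * ‖d‖ := by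
  obtain ⟨K, t, ht, hK⟩ := hf x
  refine ⟨K, K.2, ?_⟩
  filter_upwards [eventually_mem_nhds_iff.2 ht] with x' hx' d
  filter_upwards [eventually_snd_pos x', (tendsto_fst_clarkeFilter x').eventually hx',
    (tendsto_add_smul_clarkeFilter x' d).eventually hx'] with p hp h1 h2
  have h := hK.dist_le_mul _ h2 _ h1
  rw [Real.dist_eq, dist_eq_norm, add_sub_cancel_left, norm_smul, Real.norm_of_nonneg hp.le] at h
  rw [diffQuotient, abs_div, abs_of_pos hp, div_le_iff₀ hp]
  linarith

theorem clarkeDeriv_le_of_eventually (hf : LocallyLipschitz f) {c : ℝ}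
    (h : ∀ᶠ p in clarkeFilter x, diffQuotient f d p ≤ c) : clarkeDeriv f x d ≤ c := by
  obtain ⟨K, -, hK⟩ := exists_bound_diffQuotient hf x
  have hb : (clarkeFilter x).IsBoundedUnder (· ≥ ·) (diffQuotient f d) :=
    isBoundedUnder_of_eventually_ge (a := -(K * ‖d‖))
      ((hK.self_of_nhds d).mono fun p hp => (abs_le.1 hp).1)
  exact limsup_le_of_le hb.isCoboundedUnder_le h

theorem eventually_lt_of_clarkeDeriv_lt (hf : LocallyLipschitz f) {c : ℝ}
    (h : clarkeDeriv f x d < c) : ∀ᶠ p in clarkeFilter x, diffQuotient f d p < c := by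
  obtain ⟨K, -, hK⟩ := exists_bound_diffQuotient hf x
  have hb : (clarkeFilter x).IsBoundedUnder (· ≤ ·) (diffQuotient f d) :=
    isBoundedUnder_of_eventually_le (a := K * ‖d‖)
      ((hK.self_of_nhds d).mono fun p hp => (abs_le.1 hp).2)
  exact eventually_lt_of_limsup_lt h hb

theorem exists_clarkeDeriv_le_norm (hf : LocallyLipschitz f) (x : Space n) :
    ∃ K : ℝ, 0 ≤ K ∧ ∀ᶠ x' in 𝓝 x, ∀ d, clarkeDeriv f x' d ≤ K * ‖d‖ := by
  obtain ⟨K, hK0, hK⟩ := exists_bound_diffQuotient hf x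
  exact ⟨K, hK0, hK.mono fun x' hx' d =>
    clarkeDeriv_le_of_eventually hf ((hx' d).mono fun p hp => (abs_le.1 hp).2)⟩

theorem clarkeDeriv_add_le (hf : LocallyLipschitz f) (x d d' : Space n) :
    clarkeDeriv f x (d + d') ≤ clarkeDeriv f x d + clarkeDeriv f x d' := by
  refine le_of_forall_pos_le_add fun ε hε => clarkeDeriv_le_of_eventually hf ?_
  have h1 := eventually_lt_of_clarkeDeriv_lt hf
    (show clarkeDeriv f x d < clarkeDeriv f x d + ε / 2 by linarith)
  have h2 := eventually_lt_of_clarkeDeriv_lt hf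
    (show clarkeDeriv f x d' < clarkeDeriv f x d' + ε / 2 by linarith)
  have ht : Tendsto (fun p : Space n × ℝ => (p.1 + p.2 • d, p.2)) (clarkeFilter x)
      (clarkeFilter x) :=
    (tendsto_add_smul_clarkeFilter x d).prodMk (tendsto_snd_clarkeFilter x)
  filter_upwards [h1, ht.eventually h2] with p hp1 hp2
  have h3 : diffQuotient f (d + d') p =
      diffQuotient f d p + diffQuotient f d' (p.1 + p.2 • d, p.2) := by
    simp only [diffQuotient, smul_add, ← add_assoc]
    ring
  linarith

theorem clarkeDeriv_smul_le (hf : LocallyLipschitz f) (x d : Space n) {c : ℝ} (hc : 0 < c) :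
    clarkeDeriv f x (c • d) ≤ c * clarkeDeriv f x d := by
  refine le_of_forall_pos_le_add fun ε hε => clarkeDeriv_le_of_eventually hf ?_
  have h1 := eventually_lt_of_clarkeDeriv_lt hf
    (show clarkeDeriv f x d < clarkeDeriv f x d + ε / c by have := div_pos hε hc; linarith)
  have h2 : Tendsto (fun t : ℝ => c * t) (𝓝[>] 0) (𝓝[>] 0) := by
    refine tendsto_nhdsWithin_iff.2 ⟨?_, ?_⟩
    · exact (Continuous.tendsto' (by fun_prop) 0 0 (by simp)).mono_left nhdsWithin_le_nhds
    · filter_upwards [self_mem_nhdsWithin] with t ht using mul_pos hc ht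
  have ht : Tendsto (fun p : Space n × ℝ => (p.1, c * p.2)) (clarkeFilter x) (clarkeFilter x) :=
    (tendsto_fst_clarkeFilter x).prodMk (h2.comp (tendsto_snd_clarkeFilter x))
  filter_upwards [ht.eventually h1, eventually_snd_pos x] with p hp hp0
  have h3 : diffQuotient f (c • d) p = c * diffQuotient f d (p.1, c * p.2) := by
    simp only [diffQuotient, smul_smul, mul_comm p.2 c]
    field_simp
  rw [h3]
  have h4 := mul_le_mul_of_nonneg_left hp.le hc.le
  rw [mul_add, mul_div_cancel₀ _ hc.ne'] at h4
  exact h4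

theorem clarkeDeriv_smul (hf : LocallyLipschitz f) (x d : Space n) {c : ℝ} (hc : 0 < c) :
    clarkeDeriv f x (c • d) = c * clarkeDeriv f x d := by
  refine le_antisymm (clarkeDeriv_smul_le hf x d hc) ?_
  have h := clarkeDeriv_smul_le hf x (c • d) (inv_pos.2 hc)
  rw [smul_smul, inv_mul_cancel₀ hc.ne', one_smul] at h
  have h' := mul_le_mul_of_nonneg_left h hc.le
  rwa [← mul_assoc, mul_inv_cancel₀ hc.ne', one_mul] at h'

theorem clarkeDeriv_zero (f : Space n → ℝ) (x : Space n) : clarkeDeriv f x 0 = 0 := by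
  simp [clarkeDeriv]

/-- Upper semicontinuity of the Clarke directional derivative in the point and the direction. -/
theorem eventually_clarkeDeriv_sub_lt (hf : LocallyLipschitz f) {y : Space n} {c : ℝ}
    (h : clarkeDeriv f x (y - x) < c) : ∀ᶠ x' in 𝓝 x, clarkeDeriv f x' (y - x') < c := by
  obtain ⟨c', h1, h2⟩ := exists_between h
  obtain ⟨K, hK0, hK⟩ := exists_clarkeDeriv_le_norm hf x
  have h3 : ∀ᶠ x' in 𝓝 x, clarkeDeriv f x' (y - x) ≤ c' := by
    have h4 := eventually_lt_of_clarkeDeriv_lt hf h1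
    obtain ⟨pa, ha, pb, hb, hab⟩ := eventually_prod_iff.1 h4
    filter_upwards [eventually_eventually_nhds.2 ha] with x' hx'
    refine clarkeDeriv_le_of_eventually hf ?_
    exact (hx'.prod_mk hb).mono fun p hp => (hab hp.1 hp.2).le
  have h5 : ∀ᶠ x' in 𝓝 x, c' + K * ‖x - x'‖ < c := by
    have : Tendsto (fun x' => c' + K * ‖x - x'‖) (𝓝 x) (𝓝 c') :=
      Continuous.tendsto' (by fun_prop) _ _ (by simp)
    exact this.eventually (gt_mem_nhds h2)
  filter_upwards [h3, h5, hK] with x' a b k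
  have h6 := clarkeDeriv_add_le hf x' (y - x) (x - x')
  rw [sub_add_sub_cancel] at h6
  linarith [k (x - x')]

theorem clarkeDeriv_of_hasStrictFDerivAt {f' : Space n →L[ℝ] ℝ} (h : HasStrictFDerivAt f f' x)
    (d : Space n) : clarkeDeriv f x d = f' d := by
  refine Tendsto.limsup_eq (f := clarkeFilter x) (u := diffQuotient f d) ?_
  have h1 : Tendsto (fun p : Space n × ℝ => (p.1 + p.2 • d, p.1)) (clarkeFilter x) (𝓝 (x, x)) :=
    (tendsto_add_smul_clarkeFilter x d).prodMk_nhds (tendsto_fst_clarkeFilter x)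
  have h2 := h.isLittleO.comp_tendsto h1
  rw [← tendsto_sub_nhds_zero_iff]
  have h3 : (fun p : Space n × ℝ => diffQuotient f d p - f' d) =o[clarkeFilter x]
      (fun _ => ‖d‖) := by
    rw [Asymptotics.isLittleO_iff] at h2 ⊢
    intro c hc
    filter_upwards [h2 hc, eventually_snd_pos x] with p hp hp0
    simp only [Function.comp_apply, add_sub_cancel_left, map_smul, smul_eq_mul, norm_smul,
      Real.norm_of_nonneg hp0.le] at hp
    have h4 : diffQuotient f d p - f' d = (f (p.1 + p.2 • d) - f p.1 - p.2 * f' d) / p.2 := by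
      rw [diffQuotient]; field_simp
    rw [h4, norm_div, Real.norm_of_nonneg hp0.le, norm_norm, div_le_iff₀ hp0]
    linarith
  by_cases hd : ‖d‖ = 0
  · rw [norm_eq_zero] at hd
    simp [hd, diffQuotient]
  · exact (Asymptotics.isLittleO_const_iff hd).1 h3

end BundleTR

namespace BundleTR

variable {n : ℕ} {f : Space n → ℝ} {x d : Space n}

/-! ### Convexity of the standard model and its cutting planes -/

theorem convexOn_clarkeDeriv (hf : LocallyLipschitz f) (x : Space n) :
    ConvexOn ℝ Set.univ (clarkeDeriv f x) := by
  refine ⟨convex_univ, fun d _ d' _ a b ha hb hab => ?_⟩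
  rcases ha.eq_or_lt with rfl | ha
  · simp_all
  rcases hb.eq_or_lt with rfl | hb
  · simp_all
  have h := clarkeDeriv_add_le hf x (a • d) (b • d')
  rwa [clarkeDeriv_smul hf x d ha, clarkeDeriv_smul hf x d' hb] at h

theorem convexOn_standardModel (hf : LocallyLipschitz f) (x : Space n) :
    ConvexOn ℝ Set.univ (fun y => standardModel f y x) := by
  have h := ((convexOn_clarkeDeriv hf x).translate_left (-x)).add_const (f x)
  have e : (fun y => standardModel f y x) =
      (clarkeDeriv f x ∘ fun z => z + -x) + fun _ => f x := by
    ext y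
    simp [standardModel, add_comm, sub_eq_add_neg]
  rw [e]
  exact h

theorem standardModel_self (f : Space n → ℝ) (x : Space n) : standardModel f x x = f x := by
  simp [standardModel, clarkeDeriv_zero]

theorem clarkeDeriv_le_sub_of_convexOn {h : Space n → ℝ} (hh : ConvexOn ℝ Set.univ h)
    (z d : Space n) : clarkeDeriv h z d ≤ h (z + d) - h z := by
  have hl := hh.locallyLipschitz
  have hc := hl.continuous
  refine le_of_forall_pos_le_add fun ε hε => clarkeDeriv_le_of_eventually hl ?_
  have h1 : ∀ᶠ p in clarkeFilter z, h (p.1 + d) - h p.1 < h (z + d) - h z + ε := by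
    have : Tendsto (fun z' => h (z' + d) - h z') (𝓝 z) (𝓝 (h (z + d) - h z)) :=
      Continuous.tendsto (by fun_prop) z
    exact (tendsto_fst_clarkeFilter z).eventually (this.eventually (gt_mem_nhds (by linarith)))
  have h2 : ∀ᶠ p in clarkeFilter z, p.2 < 1 :=
    (tendsto_snd_clarkeFilter z).eventually
      (nhdsWithin_le_nhds (gt_mem_nhds (zero_lt_one (α := ℝ))))
  filter_upwards [h1, h2, eventually_snd_pos z] with p hp hp1 hp0
  have h3 := hh.2 (Set.mem_univ p.1) (Set.mem_univ (p.1 + d)) 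
    (show 0 ≤ 1 - p.2 by linarith) hp0.le (by ring)
  have h4 : (1 - p.2) • p.1 + p.2 • (p.1 + d) = p.1 + p.2 • d := by module
  rw [h4, smul_eq_mul, smul_eq_mul] at h3
  have h5 : diffQuotient h d p ≤ h (p.1 + d) - h p.1 := by
    rw [diffQuotient, div_le_iff₀ hp0]
    linarith
  linarith

theorem IsCutAt.le_standardModel (hf : LocallyLipschitz f) {z : Space n} {p : ℝ × Space n}
    (hp : IsCutAt (standardModel f) x z p) (y : Space n) :
    p.1 + ⟪p.2, y - x⟫ ≤ standardModel f y x := by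
  have h1 := hp.1 (y - z)
  have h2 := clarkeDeriv_le_sub_of_convexOn (convexOn_standardModel hf x) z (y - z)
  rw [add_sub_cancel] at h2
  have h3 : ⟪p.2, x - z⟫ + ⟪p.2, y - x⟫ = ⟪p.2, y - z⟫ := by
    rw [← inner_add_right, add_comm, sub_add_sub_cancel]
  have h4 := hp.2
  linarith

theorem IsWorkingSet.workingModel_le (hf : LocallyLipschitz f) {G : Set (ℝ × Space n)}
    (hG : IsWorkingSet f (standardModel f) x G) (y : Space n) :
    workingModel G x y ≤ standardModel f y x := by
  obtain ⟨hcut, g₀, -, hg₀⟩ := hG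
  have : Nonempty G := ⟨⟨_, hg₀⟩⟩
  refine ciSup_le fun p => ?_
  obtain ⟨z, hz⟩ := hcut p.1 p.2
  exact hz.le_standardModel hf y

/-! ### Criticality -/

/-- A point at which the Clarke directional derivative is nonnegative in all feasible directions
is critical. -/
theorem isCritical_of_forall_clarkeDeriv_nonneg (hf : LocallyLipschitz f) {C : Set (Space n)}
    (hC : Convex ℝ C) (hx : x ∈ C) (h : ∀ y ∈ C, 0 ≤ clarkeDeriv f x (y - x)) :
    IsCritical f C x := by
  have hcv := convexOn_clarkeDeriv hf x
  have hct : Continuous (clarkeDeriv f x) := hcv.locallyLipschitz.continuous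
  have hA1 : Convex ℝ {p : Space n × ℝ | p.1 ∈ Set.univ ∧ clarkeDeriv f x p.1 < p.2} :=
    hcv.convex_strict_epigraph
  have hA2 : IsOpen {p : Space n × ℝ | p.1 ∈ Set.univ ∧ clarkeDeriv f x p.1 < p.2} := by
    simpa using isOpen_lt (hct.comp continuous_fst) continuous_snd
  have hB : Convex ℝ {p : Space n × ℝ | p.1 + x ∈ C ∧ p.2 = 0} := by
    rintro ⟨p, r⟩ ⟨hp, hr⟩ ⟨q, s⟩ ⟨hq, hs⟩ a b ha hb hab
    simp only at hp hr hq hs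
    refine ⟨?_, by simp [hr, hs]⟩
    have h1 := hC hp hq ha hb hab
    have h2 : a • (p + x) + b • (q + x) = a • p + b • q + x := by
      rw [smul_add, smul_add, add_add_add_comm, ← add_smul, hab, one_smul]
    rw [h2] at h1
    exact h1
  obtain ⟨F, u, hF1, hF2⟩ := geometric_hahn_banach_open hA1 hA2 hB (by
    rw [Set.disjoint_left]
    rintro ⟨p, r⟩ ⟨-, hpr⟩ ⟨hp, hr⟩
    have := h _ hp
    rw [add_sub_cancel_right] at this
    simp only at hpr hr
    linarith)
  set l : Space n →L[ℝ] ℝ := F.comp (ContinuousLinearMap.inl ℝ (Space n) ℝ) with hl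
  set α : ℝ := F (0, 1) with hα
  have hF : ∀ d r, F (d, r) = l d + r * α := fun d r => by
    have : ((d, r) : Space n × ℝ) = (d, 0) + r • (0, 1) := by simp
    rw [this, map_add, map_smul, smul_eq_mul]
    rfl
  have hu0 : u ≤ 0 := by
    have := hF2 (0, 0) ⟨by simpa using hx, rfl⟩
    rw [hF] at this
    simpa using this
  have hA : ∀ d r, clarkeDeriv f x d < r → l d + r * α < u := fun d r hr => by
    have := hF1 (d, r) ⟨trivial, hr⟩
    rwa [hF] at this
  have hα0 : α < 0 := by
    have := hA 0 1 (by simp [clarkeDeriv_zero])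
    simp at this
    linarith
  have hle : ∀ d, l d ≤ -α * clarkeDeriv f x d := fun d => by
    refine le_of_forall_pos_le_add fun ε hε => ?_
    have := hA d (clarkeDeriv f x d + ε / -α) (by
      have := div_pos hε (neg_pos.2 hα0)
      linarith)
    have h2 : ε / -α * α = -ε := by
      rw [div_neg, neg_mul, div_mul_cancel₀ _ hα0.ne]
    rw [add_mul, h2] at this
    linarith
  have hu : 0 ≤ u := by
    refine le_of_forall_pos_le_add fun ε hε => ?_
    have := hA 0 (ε / -α) (by
      rw [clarkeDeriv_zero]
      exact div_pos hε (neg_pos.2 hα0))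
    have h2 : ε / -α * α = -ε := by
      rw [div_neg, neg_mul, div_mul_cancel₀ _ hα0.ne]
    rw [h2, map_zero] at this
    linarith
  have hge : ∀ y ∈ C, 0 ≤ l (y - x) := fun y hy => by
    have := hF2 (y - x, 0) ⟨by simpa using hy, rfl⟩
    rw [hF, zero_mul, add_zero] at this
    linarith
  set g : Space n := (InnerProductSpace.toDual ℝ (Space n)).symm ((-α)⁻¹ • l) with hg
  have hgd : ∀ d, ⟪g, d⟫ = (-α)⁻¹ * l d := fun d => by
    rw [hg, InnerProductSpace.toDual_symm_apply]
    rfl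
  have hαi : 0 < (-α)⁻¹ := inv_pos.2 (neg_pos.2 hα0)
  refine ⟨hx, g, fun d => ?_, -g, fun y hy => ?_, add_neg_cancel g⟩
  · rw [hgd, inv_mul_le_iff₀ (neg_pos.2 hα0)]
    exact hle d
  · rw [inner_neg_left, hgd, neg_nonpos]
    exact mul_nonneg hαi.le (hge y hy)

/-- Near a noncritical point, a single feasible point gives a uniform decrease of the standard
model. -/
theorem exists_uniform_decrease (hf : LocallyLipschitz f) {C : Set (Space n)} (hC : Convex ℝ C)
    (hx : x ∈ C) (hcrit : ¬ IsCritical f C x) :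
    ∃ y ∈ C, ∃ η > 0, ∀ᶠ x' in 𝓝 x, clarkeDeriv f x' (y - x') < -η := by
  have h : ∃ y ∈ C, clarkeDeriv f x (y - x) < 0 := by
    by_contra! h
    exact hcrit (isCritical_of_forall_clarkeDeriv_nonneg hf hC hx h)
  obtain ⟨y, hy, h⟩ := h
  exact ⟨y, hy, -clarkeDeriv f x (y - x) / 2, by linarith,
    eventually_clarkeDeriv_sub_lt hf (by linarith)⟩

/-! ### The trust-region norm -/

theorem Problem.continuous_N (Q : Problem n) : Continuous Q.N :=
  Q.N.convexOn.locallyLipschitz.continuous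

theorem Problem.exists_norm_le (Q : Problem n) : ∃ c : ℝ, 0 < c ∧ ∀ v, ‖v‖ ≤ c * Q.N v := by
  rcases (Metric.sphere (0 : Space n) 1).eq_empty_or_nonempty with hs | hs
  · refine ⟨1, one_pos, fun v => ?_⟩
    by_cases hv : v = 0
    · simp [hv]
    · have : ‖v‖⁻¹ • v ∈ Metric.sphere (0 : Space n) 1 := by
        simp [norm_smul, inv_mul_cancel₀ (norm_ne_zero_iff.2 hv)]
      rw [hs] at this
      exact this.elim
  · obtain ⟨v₀, hv₀, hmin⟩ :=
      (isCompact_sphere (0 : Space n) 1).exists_isMinOn hs Q.continuous_N.continuousOn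
    have h0 : 0 < Q.N v₀ := by
      refine lt_of_le_of_ne (apply_nonneg Q.N v₀) fun h => ?_
      rw [Q.definite v₀ h.symm] at hv₀
      simp at hv₀
    refine ⟨(Q.N v₀)⁻¹, inv_pos.2 h0, fun v => ?_⟩
    by_cases hv : v = 0
    · simp [hv]
    · have hv' := norm_pos_iff.2 hv
      have hm : ‖v‖⁻¹ • v ∈ Metric.sphere (0 : Space n) 1 := by
        simp [norm_smul, inv_mul_cancel₀ (norm_ne_zero_iff.2 hv)]
      have h1 : Q.N v₀ ≤ Q.N (‖v‖⁻¹ • v) := hmin hm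
      rw [map_smul_eq_mul, norm_inv, norm_norm, ← div_eq_inv_mul, le_div_iff₀ hv'] at h1
      rw [← div_eq_inv_mul, le_div_iff₀ h0]
      linarith

end BundleTR

namespace BundleTR

variable {n : ℕ} {P : Params} {Q : Problem n} {T : Trace n} {j : ℕ}

/-! ### General facts on the outer iterations -/

theorem Trace.Reached.of_succ (h : T.Reached (j + 1)) : T.Reached j :=
  fun i hi => h i (hi.trans (Nat.lt_succ_self j))

theorem Trace.Reached.exists_accepted (h : T.Reached (j + 1)) :
    ∃ k, T.executed j k ∧ T.accepted j k :=
  h j (Nat.lt_succ_self j)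

section Loop

variable {halt : Prop} {m : ℕ → Space n → ℝ} {shrink : ℕ → Prop}

theorem IsLoop.executed_zero (h : IsLoop P Q T j halt m shrink) :
    ∀ {k}, T.executed j k → T.executed j 0
  | 0, hk => hk
  | k + 1, hk => h.executed_zero ((h.next k).1 hk).1

theorem IsLoop.radius_pos (h : IsLoop P Q T j halt m shrink) (h0 : 0 < T.Rmem j) :
    ∀ {k}, T.executed j k → 0 < T.R j k
  | 0, hk => by rwa [h.init hk]
  | k + 1, hk => by
    obtain ⟨h1, h2⟩ := (h.next k).1 hk
    have ih := h.radius_pos h0 h1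
    by_cases hs : shrink k
    · rw [h.radius_halve k h1 h2 hs]
      exact half_pos ih
    · rwa [h.radius_keep k h1 h2 hs]

/-- Either the radius is still the memory radius, or some earlier step halved it to its present
value. -/
theorem IsLoop.radius_eq_or (h : IsLoop P Q T j halt m shrink) :
    ∀ {k}, T.executed j k → T.R j k = T.Rmem j ∨
      ∃ i, T.executed j i ∧ ¬ T.accepted j i ∧ shrink i ∧ T.R j i = 2 * T.R j k
  | 0, hk => Or.inl (h.init hk)
  | k + 1, hk => by
    obtain ⟨h1, h2⟩ := (h.next k).1 hk
    by_cases hs : shrink k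
    · refine Or.inr ⟨k, h1, h2, hs, ?_⟩
      rw [h.radius_halve k h1 h2 hs]
      ring
    · rw [h.radius_keep k h1 h2 hs]
      exact h.radius_eq_or h1

theorem IsLoop.memory_eq_or (h : IsLoop P Q T j halt m shrink) {k : ℕ} (hk : T.executed j k)
    (ha : T.accepted j k) : T.Rmem (j + 1) = T.R j k ∨ T.Rmem (j + 1) = 2 * T.R j k :=
  (lt_or_ge _ _).imp (h.memory_keep k hk ha) (h.memory_double k hk ha)

theorem IsLoop.norm_trial_sub_le (h : IsLoop P Q T j halt m shrink) {c : ℝ} (hc : 0 < c)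
    (hcN : ∀ v, ‖v‖ ≤ c * Q.N v) {k : ℕ} (hk : T.executed j k) :
    ‖T.z j k - T.x j‖ ≤ c * P.M * T.R j k := by
  have h1 := (h.trial k hk).2.1
  have h2 := (h.tangent k hk).1.2
  rw [map_sub_rev] at h2
  have h3 := mul_le_mul_of_nonneg_left h2 (zero_le_one.trans P.one_le_M)
  calc ‖T.z j k - T.x j‖ ≤ c * Q.N (T.z j k - T.x j) := hcN _
    _ ≤ c * (P.M * T.R j k) := mul_le_mul_of_nonneg_left (h1.trans h3) hc.le
    _ = c * P.M * T.R j k := by ring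

end Loop

/-- Every outer iteration of `T` is that of some trust-region algorithm. -/
def IsTrustRegionRun (P : Params) (Q : Problem n) (T : Trace n) : Prop :=
  0 < T.Rmem 0 ∧ ∀ j, ∃ halt m shrink, IsLoop P Q T j halt m shrink

theorem IsTrustRegionRun.memory_pos (h : IsTrustRegionRun P Q T) :
    ∀ {j}, T.Reached j → 0 < T.Rmem j
  | 0, _ => h.1
  | j + 1, hj => by
    obtain ⟨k, hk, ha⟩ := hj.exists_accepted
    obtain ⟨halt, m, shrink, hl⟩ := h.2 j
    have hR := hl.radius_pos (h.memory_pos hj.of_succ) hk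
    rcases hl.memory_eq_or hk ha with e | e <;> rw [e] <;> linarith

theorem IsTrustRegionRun.mem (h : IsTrustRegionRun P Q T) (h0 : T.x 0 ∈ Q.C) :
    ∀ {j}, T.Reached j → T.x j ∈ Q.C
  | 0, _ => h0
  | j + 1, hj => by
    obtain ⟨k, hk, ha⟩ := hj.exists_accepted
    obtain ⟨halt, m, shrink, hl⟩ := h.2 j
    rw [hl.serious k hk ha]
    exact (hl.trial k hk).1

theorem IsBundleRun.isTrustRegionRun {φ : Space n → Space n → ℝ} {x₁ : Space n}
    (h : IsBundleRun P Q φ x₁ T) : IsTrustRegionRun P Q T := by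
  obtain ⟨-, h0, G, hG⟩ := h
  exact ⟨h0, fun j => ⟨_, _, _, (hG j).loop⟩⟩

theorem IsClassicalRun.isTrustRegionRun {x₁ : Space n}
    (h : IsClassicalRun P Q x₁ T) : IsTrustRegionRun P Q T :=
  ⟨h.2.1, fun j => ⟨_, _, _, (h.2.2 j).loop⟩⟩

/-! ### Decrease of the model -/

/-- The tangent program reduces a model dominated by the standard model at least as much as the
standard model decreases on the way to a feasible point, cut at the trust-region radius. -/
theorem IsTangentSolution.decrease (hf : LocallyLipschitz Q.f) {m : Space n → ℝ}
    {x y y' : Space n} {R η L : ℝ} (hm : ∀ w, m w ≤ standardModel Q.f w x) (hx : x ∈ Q.C)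
    (hR : 0 < R) (hy : IsTangentSolution Q m x R y) (hy' : y' ∈ Q.C) (hη : 0 ≤ η) (hL : 0 < L)
    (hL' : Q.N (y' - x) ≤ L) (hd : clarkeDeriv Q.f x (y' - x) ≤ -η) :
    min η (η / L * R) ≤ Q.f x - m y := by
  set t := min 1 (R / L) with ht
  have ht0 : 0 < t := lt_min one_pos (div_pos hR hL)
  have ht1 : t ≤ 1 := min_le_left _ _
  have htL : t * L ≤ R := (le_div_iff₀ hL).1 (min_le_right _ _)
  have hmem : x + t • (y' - x) ∈ Q.C := Q.convex.add_smul_sub_mem hx hy' ⟨ht0.le, ht1⟩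
  have hN : Q.N (x + t • (y' - x) - x) ≤ R := by
    rw [add_sub_cancel_left, map_smul_eq_mul, Real.norm_of_nonneg ht0.le]
    exact (mul_le_mul_of_nonneg_left hL' ht0.le).trans htL
  have h1 := (hy.2 _ hmem hN).trans (hm _)
  rw [standardModel, add_sub_cancel_left, clarkeDeriv_smul hf x _ ht0] at h1
  have h2 := mul_le_mul_of_nonneg_left hd ht0.le
  have h3 : min η (η / L * R) = t * η := by
    rw [ht, min_mul_of_nonneg _ _ hη, one_mul]
    congr 1
    ring
  rw [h3]
  linarith

theorem IsTangentSolution.le_of_mem {m : Space n → ℝ} {x y : Space n} {R : ℝ} (hx : x ∈ Q.C)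
    (hR : 0 ≤ R) (hy : IsTangentSolution Q m x R y) : m y ≤ m x :=
  hy.2 x hx (by simpa using hR)

/-! ### An abstract convergence argument -/

/-- Let the steps of a sequence be controlled by radii `ρ`, and let the decrease of the objective
values near a cluster point be controlled from below by the radii. If the radius does not decrease
in iterations without property `H`, then iterations with property `H` occur arbitrarily close to
the cluster point and with arbitrarily small radii. -/
theorem exists_near_clusterPt {E : Type*} [PseudoMetricSpace E] {x : ℕ → E} {φ ρ : ℕ → ℝ}
    {H : ℕ → Prop} {xs : E} {φs κ a b δ : ℝ} (hκ : 0 < κ) (ha : 0 < a) (hb : 0 < b) (hδ : 0 < δ)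
    (hcl : MapClusterPt xs atTop x) (hφ : Antitone φ) (hφs : Tendsto φ atTop (𝓝 φs))
    (hρ : ∀ i, 0 < ρ i) (hstep : ∀ i, dist (x (i + 1)) (x i) ≤ κ * ρ i)
    (hdec : ∀ i, dist (x i) xs < δ → min a (b * ρ i) ≤ φ i - φ (i + 1))
    (hH : ∀ i, ¬ H (i + 1) → ρ i ≤ ρ (i + 1)) {ε : ℝ} (hε : 0 < ε) :
    ∃ i, H i ∧ dist (x i) xs < ε ∧ ρ i < ε := by
  wlog hεδ : ε ≤ δ generalizing ε
  · obtain ⟨i, h1, h2, h3⟩ := this hδ le_rfl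
    exact ⟨i, h1, h2.trans (not_le.1 hεδ), h3.trans (not_le.1 hεδ)⟩
  have hge : ∀ i, φs ≤ φ i := fun i => hφ.le_of_tendsto hφs i
  have hsmall : ∀ c > 0, ∀ᶠ i in atTop, φ i - φs < c := fun c hc => by
    filter_upwards [hφs.eventually (gt_mem_nhds (show φs < φs + c by linarith))] with i hi
    linarith
  obtain ⟨j₀, hj₀a, hj₀b⟩ :=
    ((hsmall a ha).and (hsmall (b * (ε / (4 * κ))) (by positivity))).exists
  have hdec' : ∀ i, j₀ ≤ i → dist (x i) xs < δ → b * ρ i ≤ φ i - φ (i + 1) := fun i hi hd => by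
    refine (min_le_iff.1 (hdec i hd)).resolve_left fun h => ?_
    linarith [hφ hi, hge (i + 1)]
  by_contra! hno
  obtain ⟨r, hr0, hrj, hrε, hrκ⟩ : ∃ r > 0, r ≤ ρ j₀ ∧ r ≤ ε ∧ r ≤ ε / (4 * κ) :=
    ⟨min (ρ j₀) (min ε (ε / (4 * κ))), by have := hρ j₀; positivity, min_le_left _ _,
      (min_le_right _ _).trans (min_le_left _ _), (min_le_right _ _).trans (min_le_right _ _)⟩
  obtain ⟨j, hjd, hjs, hj⟩ : ∃ j, dist (x j) xs < ε / 4 ∧ φ j - φs < b * r ∧ j₀ ≤ j :=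
    ((hcl.frequently (Metric.ball_mem_nhds xs (show 0 < ε / 4 by linarith))).and_eventually
      ((hsmall (b * r) (by positivity)).and (eventually_ge_atTop j₀))).exists
  have hρj : ρ j < r := by
    have h1 := hdec' j hj (by linarith)
    have h2 := hge (j + 1)
    exact lt_of_mul_lt_mul_left (by linarith) hb.le
  have hκr : κ * (ε / (4 * κ)) = ε / 4 := by field_simp
  have key : ∀ d i, i + d = j → j₀ ≤ i →
      dist (x i) xs ≤ ε / 4 + κ / b * (φ i - φ j) ∧ ρ i ≤ ρ j := by
    intro d
    induction d with
    | zero =>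
      rintro i rfl -
      simp only [add_zero] at *
      simpa using hjd.le
    | succ d ih =>
      intro i hi hi0
      obtain ⟨h1, h2⟩ := ih (i + 1) (by omega) (by omega)
      have h3 : κ / b * (φ (i + 1) - φ j) ≤ ε / 4 := by
        have : φ (i + 1) - φ j ≤ b * (ε / (4 * κ)) := by
          linarith [hφ (show j₀ ≤ i + 1 by omega), hge j]
        calc κ / b * (φ (i + 1) - φ j) ≤ κ / b * (b * (ε / (4 * κ))) := by gcongr
          _ = ε / 4 := by field_simp
      have h4 : ¬ H (i + 1) := fun h => by
        have := hno (i + 1) h (by linarith)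
        linarith
      have h5 : ρ i ≤ ρ j := (hH i h4).trans h2
      have h6 : dist (x i) (x (i + 1)) ≤ κ * ρ i := by
        rw [dist_comm]
        exact hstep i
      have h7 : κ * ρ i ≤ ε / 4 := by
        rw [← hκr]
        exact mul_le_mul_of_nonneg_left (by linarith) hκ.le
      have h8 := dist_triangle (x i) (x (i + 1)) xs
      have h9 := hdec' i hi0 (by linarith)
      have h10 : κ * ρ i ≤ κ / b * (φ i - φ (i + 1)) := by
        calc κ * ρ i = κ / b * (b * ρ i) := by field_simp
          _ ≤ _ := by gcongr
      refine ⟨?_, h5⟩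
      have h11 : κ / b * (φ i - φ j) =
          κ / b * (φ i - φ (i + 1)) + κ / b * (φ (i + 1) - φ j) := by ring
      linarith
  have := (key (j - j₀) j₀ (by omega) le_rfl).2
  linarith

end BundleTR

namespace BundleTR

variable {n : ℕ} {P : Params} {Q : Problem n} {T : Trace n} {j : ℕ} {x₁ : Space n}

/-! ### Accumulation points of the serious iterates -/

section BundleLoop

variable {G : ℕ → Set (ℝ × Space n)} {k : ℕ}

theorem IsBundleLoop.workingModel_le (h : IsBundleLoop P Q (standardModel Q.f) T j G)
    (hf : LocallyLipschitz Q.f) (hk : T.executed j k) (y : Space n) :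
    workingModel (G k) (T.x j) y ≤ standardModel Q.f y (T.x j) :=
  (h.working k hk).workingModel_le hf y

theorem IsBundleLoop.f_le_of_accepted (h : IsBundleLoop P Q (standardModel Q.f) T j G)
    (hf : LocallyLipschitz Q.f) (hx : T.x j ∈ Q.C) (hR : 0 < T.R j k) (hk : T.executed j k)
    (ha : T.accepted j k) :
    P.γ * P.θ * (Q.f (T.x j) - workingModel (G k) (T.x j) (T.y j k)) ≤
        Q.f (T.x j) - Q.f (T.x (j + 1)) ∧ Q.f (T.x (j + 1)) ≤ Q.f (T.x j) := by
  have h1 := (h.loop.tangent k hk).le_of_mem hx hR.le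
  have h2 := h.workingModel_le hf hk (T.x j)
  rw [standardModel_self] at h2
  have h3 := (h.loop.trial k hk).2.2
  have h4 := (h.loop.accept k hk).1 ha
  have h0 : 0 ≤ P.θ * (Q.f (T.x j) - workingModel (G k) (T.x j) (T.y j k)) :=
    mul_nonneg P.θ_pos.le (by linarith)
  rw [h.loop.serious k hk ha]
  have hpos : 0 < Q.f (T.x j) - workingModel (G k) (T.x j) (T.z j k) := by
    refine lt_of_le_of_ne (h0.trans h3) fun h5 => ?_
    rw [testQuotient, ← h5, div_zero] at h4
    exact absurd P.γ_pos (not_lt.2 h4)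
  rw [testQuotient, le_div_iff₀ hpos] at h4
  have h6 := mul_le_mul_of_nonneg_left h3 P.γ_pos.le
  rw [← mul_assoc] at h6
  exact ⟨h6.trans h4, by linarith [mul_pos P.γ_pos hpos]⟩

/-- After a null step with halved radius, the objective exceeds the standard model by a fixed
fraction of the predicted decrease. -/
theorem IsBundleLoop.sub_standardModel_ge (h : IsBundleLoop P Q (standardModel Q.f) T j G)
    (hk : T.executed j k) (ha : ¬ T.accepted j k)
    (hs : P.γt ≤ (Q.f (T.x j) - standardModel Q.f (T.z j k) (T.x j)) /
      (Q.f (T.x j) - workingModel (G k) (T.x j) (T.z j k)))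
    (hpos : 0 < Q.f (T.x j) - workingModel (G k) (T.x j) (T.y j k)) :
    (P.γt - P.γ) * P.θ * (Q.f (T.x j) - workingModel (G k) (T.x j) (T.y j k)) ≤
      Q.f (T.z j k) - standardModel Q.f (T.z j k) (T.x j) := by
  have h3 := (h.loop.trial k hk).2.2
  have hD := (mul_pos P.θ_pos hpos).trans_le h3
  have h4 := mt (h.loop.accept k hk).2 ha
  rw [testQuotient, not_le, div_lt_iff₀ hD] at h4
  rw [le_div_iff₀ hD] at hs
  have h6 := mul_le_mul_of_nonneg_left h3 (sub_pos.2 P.γ_lt_γt).le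
  rw [← mul_assoc] at h6
  linarith

end BundleLoop

/-- If the standard model is strict on the constraint set, then every accumulation point of the
serious iterates of the bundle trust-region algorithm is critical. -/
theorem isCritical_of_mapClusterPt (hf : LocallyLipschitz Q.f) (hx₁ : x₁ ∈ Q.C)
    (hstrict : ∀ x ∈ Q.C, IsStrictModelAt Q.f (standardModel Q.f) x)
    (hT : IsBundleRun P Q (standardModel Q.f) x₁ T) (hreach : ∀ j, T.Reached j)
    {xs : Space n} (hxs : MapClusterPt xs atTop T.x) : IsCritical Q.f Q.C xs := by
  by_contra hcrit
  have hTR := hT.isTrustRegionRun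
  obtain ⟨hx0, -, G, hG⟩ := hT
  have hxC : ∀ j, T.x j ∈ Q.C := fun j => hTR.mem (hx0 ▸ hx₁) (hreach j)
  have hmem : ∀ j, 0 < T.Rmem j := fun j => hTR.memory_pos (hreach j)
  have hR : ∀ j k, T.executed j k → 0 < T.R j k := fun j k hk =>
    (hG j).loop.radius_pos (hmem j) hk
  have hxsC : xs ∈ Q.C := by
    refine Q.closed.mem_of_frequently_of_tendsto ?_ tendsto_id (b := 𝓝 xs)
    rw [frequently_iff]
    intro U hU
    obtain ⟨j, hj⟩ := (hxs.frequently hU).exists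
    exact ⟨_, hj, hxC j⟩
  choose K hK hKa using fun j => (hreach (j + 1)).exists_accepted
  obtain ⟨c, hc, hcN⟩ := Q.exists_norm_le
  obtain ⟨y', hy', η, hη, hnear⟩ := exists_uniform_decrease hf Q.convex hxsC hcrit
  set L := Q.N (y' - xs) + 1 with hL
  have hL0 : 0 < L := by have := apply_nonneg Q.N (y' - xs); linarith
  have hnearL : ∀ᶠ x in 𝓝 xs, Q.N (y' - x) < L := by
    have hcont : Continuous fun x => Q.N (y' - x) := Q.continuous_N.comp (by fun_prop)
    exact (hcont.tendsto xs).eventually (gt_mem_nhds (by rw [hL]; linarith))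
  obtain ⟨δ, hδ, hball⟩ := Metric.eventually_nhds_iff.1 (hnear.and hnearL)
  have hmodel : ∀ j k, T.executed j k → dist (T.x j) xs < δ →
      min η (η / L * T.R j k) ≤
        Q.f (T.x j) - workingModel (G j k) (T.x j) (T.y j k) := fun j k hk hd =>
    ((hG j).loop.tangent k hk).decrease hf ((hG j).workingModel_le hf hk) (hxC j) (hR j k hk)
      hy' hη.le hL0 (hball hd).2.le (hball hd).1.le
  have hanti : Antitone fun j => Q.f (T.x j) := antitone_nat_of_succ_le fun j =>
    ((hG j).f_le_of_accepted hf (hxC j) (hR j _ (hK j)) (hK j) (hKa j)).2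
  have hlim : Tendsto (fun j => Q.f (T.x j)) atTop (𝓝 (Q.f xs)) := by
    obtain ⟨ψ, hψ, hψl⟩ := hxs.tendsto_subseq
    exact (tendsto_iff_tendsto_subseq_of_antitone hanti hψ.tendsto_atTop).2
      ((hf.continuous.tendsto xs).comp hψl)
  set κ := c * P.M with hκ
  have hκ0 : 0 < κ := mul_pos hc (one_pos.trans_le P.one_le_M)
  have hγθ : 0 < P.γ * P.θ := mul_pos P.γ_pos P.θ_pos
  have hhalve := fun ε (hε : (0 : ℝ) < ε) => exists_near_clusterPt
    (H := fun j => ∃ k, T.executed j k ∧ ¬ T.accepted j k ∧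
      P.γt ≤ (Q.f (T.x j) - standardModel Q.f (T.z j k) (T.x j)) /
        (Q.f (T.x j) - workingModel (G j k) (T.x j) (T.z j k)) ∧
      T.R j k = 2 * T.R j (K j))
    (ρ := fun j => T.R j (K j)) (a := P.γ * P.θ * η) (b := P.γ * P.θ * (η / L)) (δ := δ)
    hκ0 (by positivity) (by positivity) hδ hxs hanti hlim (fun j => hR j _ (hK j))
    (fun j => by
      rw [dist_eq_norm, (hG j).loop.serious _ (hK j) (hKa j)]
      exact (hG j).loop.norm_trial_sub_le hc hcN (hK j))
    (fun j hd => by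
      have h1 := ((hG j).f_le_of_accepted hf (hxC j) (hR j _ (hK j)) (hK j) (hKa j)).1
      have h2 := mul_le_mul_of_nonneg_left (hmodel j _ (hK j) hd) hγθ.le
      rw [mul_min_of_nonneg _ _ hγθ.le, ← mul_assoc] at h2
      exact h2.trans h1)
    (fun j hj => by
      have h1 := ((hG (j + 1)).loop.radius_eq_or (hK (j + 1))).resolve_right hj
      have h2 := hR j _ (hK j)
      simp only [h1]
      rcases (hG j).loop.memory_eq_or (hK j) (hKa j) with e | e <;> rw [e]
      linarith) hε
  choose i hi hid hiR using fun m : ℕ =>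
    hhalve (1 / ((m : ℝ) + 1)) Nat.one_div_pos_of_nat
  choose k hk hka hks hkR using hi
  have hlimx : Tendsto (fun m => T.x (i m)) atTop (𝓝 xs) :=
    tendsto_iff_dist_tendsto_zero.2 (squeeze_zero (fun _ => dist_nonneg) (fun m => (hid m).le)
      tendsto_one_div_add_atTop_nhds_zero_nat)
  have hlimR : Tendsto (fun m => T.R (i m) (k m)) atTop (𝓝 0) := by
    refine squeeze_zero (g := fun m : ℕ => 2 * (1 / ((m : ℝ) + 1)))
      (fun m => (hR _ _ (hk m)).le) (fun m => ?_) ?_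
    · rw [hkR m]
      linarith [hiR m]
    · simpa using (tendsto_one_div_add_atTop_nhds_zero_nat (𝕜 := ℝ)).const_mul 2
  have hzx : ∀ m, ‖T.z (i m) (k m) - T.x (i m)‖ ≤ κ * T.R (i m) (k m) := fun m =>
    (hG (i m)).loop.norm_trial_sub_le hc hcN (hk m)
  have hlimz : Tendsto (fun m => T.z (i m) (k m)) atTop (𝓝 xs) := by
    have h1 : Tendsto (fun m => T.z (i m) (k m) - T.x (i m)) atTop (𝓝 0) :=
      squeeze_zero_norm hzx (by simpa using hlimR.const_mul κ)
    simpa using h1.add hlimx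
  obtain ⟨ε, hε0, hεl, hε⟩ := hstrict xs hxsC _ _ hlimz hlimx
  have hγ : 0 < (P.γt - P.γ) * P.θ := mul_pos (sub_pos.2 P.γ_lt_γt) P.θ_pos
  have hfin : ∀ᶠ m in atTop, dist (T.x (i m)) xs < δ ∧ T.R (i m) (k m) < L ∧
      ε m < (P.γt - P.γ) * P.θ * (η / L) / κ :=
    (hlimx.eventually (Metric.ball_mem_nhds xs hδ)).and
      ((hlimR.eventually (gt_mem_nhds hL0)).and (hεl.eventually (gt_mem_nhds (by positivity))))
  obtain ⟨m, hm1, hm2, hm3⟩ := hfin.exists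
  have hRm := hR _ _ (hk m)
  have h1 := hmodel _ _ (hk m) hm1
  have h2 : min η (η / L * T.R (i m) (k m)) = η / L * T.R (i m) (k m) := by
    refine min_eq_right ?_
    calc η / L * T.R (i m) (k m) ≤ η / L * L := by gcongr
      _ = η := by field_simp
  rw [h2] at h1
  have hpos : 0 < η / L * T.R (i m) (k m) := by positivity
  have h3 := (hG (i m)).sub_standardModel_ge (hk m) (hka m) (hks m) (hpos.trans_le h1)
  have h4 := mul_le_mul_of_nonneg_left h1 hγ.le
  have h5 := hε m
  have h6 : ε m * ‖T.z (i m) (k m) - T.x (i m)‖ ≤ ε m * (κ * T.R (i m) (k m)) :=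
    mul_le_mul_of_nonneg_left (hzx m) (hε0 m).le
  have h7 : ε m * (κ * T.R (i m) (k m)) <
      (P.γt - P.γ) * P.θ * (η / L * T.R (i m) (k m)) := by
    rw [lt_div_iff₀ hκ0] at hm3
    have := mul_lt_mul_of_pos_right hm3 hRm
    calc _ = ε m * κ * T.R (i m) (k m) := by ring
      _ < _ := this
      _ = _ := by ring
  linarith

end BundleTR

namespace BundleTR

variable {n : ℕ} {P : Params} {Q : Problem n} {T : Trace n} {j : ℕ} {x₁ : Space n}
  {f : Space n → ℝ} {x : Space n}

/-! ### Serious iterates of strict differentiability -/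

theorem StrictlyDifferentiableAt.hasStrictFDerivAt (h : StrictlyDifferentiableAt f x) :
    HasStrictFDerivAt f (fderiv ℝ f x) x := by
  obtain ⟨f', hf'⟩ := h
  rwa [hf'.hasFDerivAt.fderiv]

theorem StrictlyDifferentiableAt.clarkeDeriv_eq (h : StrictlyDifferentiableAt f x) (d : Space n) :
    clarkeDeriv f x d = ⟪gradient f x, d⟫ := by
  rw [clarkeDeriv_of_hasStrictFDerivAt h.hasStrictFDerivAt, inner_gradient_left]

theorem setOf_inner_le_eq_singleton (g₀ : Space n) :
    {g : Space n | ∀ d, ⟪g, d⟫ ≤ ⟪g₀, d⟫} = {g₀} := by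
  ext g
  refine ⟨fun h => ?_, ?_⟩
  · have h1 := h (g - g₀)
    rw [← sub_nonpos, ← inner_sub_left] at h1
    exact sub_eq_zero.1 (real_inner_self_nonpos.1 h1)
  · rintro rfl d
    exact le_rfl

theorem StrictlyDifferentiableAt.clarkeSubdiff_eq (h : StrictlyDifferentiableAt f x) :
    clarkeSubdiff f x = {gradient f x} := by
  simp only [clarkeSubdiff, h.clarkeDeriv_eq, setOf_inner_le_eq_singleton]

theorem StrictlyDifferentiableAt.standardModel_eq (h : StrictlyDifferentiableAt f x)
    (y : Space n) : standardModel f y x = taylorModel f x y := by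
  rw [standardModel, taylorModel, h.clarkeDeriv_eq]

theorem StrictlyDifferentiableAt.isCritical_iff (h : StrictlyDifferentiableAt f x)
    {C : Set (Space n)} (hx : x ∈ C) :
    IsCritical f C x ↔ -gradient f x ∈ normalCone C x := by
  simp only [IsCritical, hx, h.clarkeSubdiff_eq, Set.mem_singleton_iff, true_and, exists_eq_left]
  constructor
  · rintro ⟨q, hq, h0⟩
    rwa [neg_eq_of_add_eq_zero_right h0]
  · exact fun hq => ⟨_, hq, add_neg_cancel _⟩

theorem StrictlyDifferentiableAt.isCutAt_iff (h : StrictlyDifferentiableAt f x) (z : Space n)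
    (p : ℝ × Space n) : IsCutAt (standardModel f) x z p ↔ p = (f x, gradient f x) := by
  have hd : HasStrictFDerivAt (fun y => standardModel f y x)
      (innerSL ℝ (gradient f x)) z := by
    have e : (fun y => standardModel f y x) = fun y => f x + innerSL ℝ (gradient f x) (y - x) := by
      ext y
      rw [h.standardModel_eq]
      rfl
    rw [e]
    exact (((innerSL ℝ (gradient f x)).hasStrictFDerivAt (x := z - x)).comp z
      ((hasStrictFDerivAt_id z).sub_const x)).const_add (f x)
  have hs : clarkeSubdiff (fun y => standardModel f y x) z = {gradient f x} := by
    simp only [clarkeSubdiff, clarkeDeriv_of_hasStrictFDerivAt hd, innerSL_apply_apply,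
      setOf_inner_le_eq_singleton]
  have h0 : standardModel f z x + ⟪gradient f x, x - z⟫ = f x := by
    rw [h.standardModel_eq, taylorModel, add_assoc, ← inner_add_right]
    simp
  rw [IsCutAt, hs, Set.mem_singleton_iff, Prod.ext_iff]
  constructor
  · rintro ⟨h1, h2⟩
    exact ⟨by rw [h2, h1, h0], h1⟩
  · rintro ⟨h1, h2⟩
    exact ⟨h2, by rw [h1, h2, h0]⟩

theorem StrictlyDifferentiableAt.isWorkingSet_iff (h : StrictlyDifferentiableAt f x)
    (G : Set (ℝ × Space n)) :
    IsWorkingSet f (standardModel f) x G ↔ G = {(f x, gradient f x)} := by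
  simp only [IsWorkingSet, h.isCutAt_iff, exists_const, h.clarkeSubdiff_eq,
    Set.mem_singleton_iff, exists_eq_left]
  constructor
  · rintro ⟨h1, h2⟩
    exact Set.eq_singleton_iff_unique_mem.2 ⟨h2, h1⟩
  · rintro rfl
    simp

theorem workingModel_singleton (f : Space n → ℝ) (x : Space n) :
    workingModel {(f x, gradient f x)} x = taylorModel f x := by
  ext y
  simp [workingModel, taylorModel]

/-- Away from critical points the Taylor model predicts a positive decrease at trial steps. -/
theorem taylorModel_decrease_pos (hf : LocallyLipschitz Q.f)
    (h : StrictlyDifferentiableAt Q.f x) (hx : x ∈ Q.C)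
    (hcrit : ¬ -gradient Q.f x ∈ normalCone Q.C x) {R : ℝ} (hR : 0 < R) {y z : Space n}
    (hy : IsTangentSolution Q (taylorModel Q.f x) x R y)
    (hz : IsTrialStep P Q (taylorModel Q.f x) x y z) : 0 < Q.f x - taylorModel Q.f x z := by
  obtain ⟨y', hy', hlt⟩ : ∃ y' ∈ Q.C, ⟪gradient Q.f x, y' - x⟫ < 0 := by
    simpa [normalCone] using hcrit
  have hL : 0 < Q.N (y' - x) + 1 := by have := apply_nonneg Q.N (y' - x); linarith
  have h1 := hy.decrease hf (fun w => (h.standardModel_eq w).ge) hx hR hy'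
    (neg_nonneg.2 hlt.le) hL (by linarith) (by rw [h.clarkeDeriv_eq, neg_neg])
  have h2 : 0 < min (-⟪gradient Q.f x, y' - x⟫)
      (-⟪gradient Q.f x, y' - x⟫ / (Q.N (y' - x) + 1) * R) :=
    lt_min (neg_pos.2 hlt) (mul_pos (div_pos (neg_pos.2 hlt) hL) hR)
  exact (mul_pos P.θ_pos (h2.trans_le h1)).trans_le hz.2.2

theorem IsLoop.congr {halt halt' : Prop} {m m' : ℕ → Space n → ℝ} {shrink shrink' : ℕ → Prop}
    (h : IsLoop P Q T j halt m shrink) (hh : T.Reached j → (halt ↔ halt'))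
    (hm : ∀ k, T.executed j k → m k = m' k)
    (hs : ∀ k, T.executed j k → (shrink k ↔ shrink' k)) :
    IsLoop P Q T j halt' m' shrink' where
  enter := by
    rw [h.enter]
    exact and_congr_right fun hj => not_congr (hh hj)
  next := h.next
  init := h.init
  tangent k hk := hm k hk ▸ h.tangent k hk
  trial k hk := hm k hk ▸ h.trial k hk
  accept k hk := hm k hk ▸ h.accept k hk
  serious := h.serious
  memory_keep k hk := hm k hk ▸ h.memory_keep k hk
  memory_double k hk := hm k hk ▸ h.memory_double k hk
  radius_keep k hk ha hn := h.radius_keep k hk ha (mt (hs k hk).1 hn)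
  radius_halve k hk ha hn := h.radius_halve k hk ha ((hs k hk).2 hn)

theorem IsLoop.taylor_decrease_pos (hf : LocallyLipschitz Q.f) {shrink : ℕ → Prop}
    (h : IsLoop P Q T j (-gradient Q.f (T.x j) ∈ normalCone Q.C (T.x j))
      (fun _ => taylorModel Q.f (T.x j)) shrink)
    (hd : StrictlyDifferentiableAt Q.f (T.x j)) (hx : T.x j ∈ Q.C) (hR : 0 < T.Rmem j) {k : ℕ}
    (hk : T.executed j k) : 0 < Q.f (T.x j) - taylorModel Q.f (T.x j) (T.z j k) :=
  taylorModel_decrease_pos hf hd hx (h.enter.1 (h.executed_zero hk)).2 (h.radius_pos hR hk)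
    (h.tangent k hk) (h.trial k hk)

theorem secondary_quotient_ge (hd : StrictlyDifferentiableAt f x) {z : Space n}
    (h : 0 < f x - taylorModel f x z) :
    P.γt ≤ (f x - standardModel f z x) / (f x - taylorModel f x z) := by
  rw [hd.standardModel_eq, div_self h.ne']
  exact P.γt_lt_one.le

/-- An outer iteration of the bundle algorithm at a point of strict differentiability is an outer
iteration of the classical algorithm. -/
theorem IsBundleLoop.isClassicalLoop (hf : LocallyLipschitz Q.f) {G : ℕ → Set (ℝ × Space n)}
    (h : IsBundleLoop P Q (standardModel Q.f) T j G)
    (hd : T.Reached j → StrictlyDifferentiableAt Q.f (T.x j)) (hx : T.Reached j → T.x j ∈ Q.C)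
    (hR : T.Reached j → 0 < T.Rmem j) : IsClassicalLoop P Q T j := by
  have hreach : ∀ {k}, T.executed j k → T.Reached j := fun hk =>
    (h.loop.enter.1 (h.loop.executed_zero hk)).1
  have hm : ∀ k, T.executed j k → workingModel (G k) (T.x j) = taylorModel Q.f (T.x j) :=
    fun k hk => by
      rw [((hd (hreach hk)).isWorkingSet_iff _).1 (h.working k hk), workingModel_singleton]
  have h1 := h.loop.congr (fun hj => (hd hj).isCritical_iff (hx hj)) hm (fun k hk => Iff.rfl)
  refine ⟨fun hj => (hd hj).hasStrictFDerivAt.differentiableAt,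
    h1.congr (fun _ => Iff.rfl) (fun _ _ => rfl) fun k hk => iff_true_intro ?_⟩
  have hj := hreach hk
  rw [hm k hk]
  exact secondary_quotient_ge (hd hj)
    (h1.taylor_decrease_pos hf (hd hj) (hx hj) (hR hj) hk)

/-- An outer iteration of the classical algorithm at a point of strict differentiability is an
outer iteration of the bundle algorithm, with a single cutting plane. -/
theorem IsClassicalLoop.isBundleLoop (hf : LocallyLipschitz Q.f) (h : IsClassicalLoop P Q T j)
    (hd : T.Reached j → StrictlyDifferentiableAt Q.f (T.x j)) (hx : T.Reached j → T.x j ∈ Q.C)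
    (hR : T.Reached j → 0 < T.Rmem j) :
    IsBundleLoop P Q (standardModel Q.f) T j
      (fun _ => {(Q.f (T.x j), gradient Q.f (T.x j))}) := by
  have hreach : ∀ {k}, T.executed j k → T.Reached j := fun hk =>
    (h.loop.enter.1 (h.loop.executed_zero hk)).1
  refine ⟨fun k hk => ((hd (hreach hk)).isWorkingSet_iff _).2 rfl,
    fun k hk _ => ⟨_, rfl, ((hd (hreach hk)).isCutAt_iff _ _).2 rfl⟩,
    h.loop.congr (fun hj => ((hd hj).isCritical_iff (hx hj)).symm)
      (fun _ _ => (workingModel_singleton _ _).symm) fun k hk => ⟨fun _ => ?_, fun _ => trivial⟩⟩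
  have hj := hreach hk
  rw [workingModel_singleton]
  exact secondary_quotient_ge (hd hj)
    (h.loop.taylor_decrease_pos hf (hd hj) (hx hj) (hR hj) hk)

theorem IsTrustRegionRun.strictlyDifferentiableAt_succ (h : IsTrustRegionRun P Q T)
    {w : ℕ → Space n} (hw : ∀ i, StrictlyDifferentiableAt Q.f (w i)) (hT : T.DrawnFrom w)
    (hj : T.Reached (j + 1)) : StrictlyDifferentiableAt Q.f (T.x (j + 1)) := by
  obtain ⟨k, hk, ha⟩ := hj.exists_accepted
  obtain ⟨halt, m, shrink, hl⟩ := h.2 j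
  obtain ⟨idx, hidx, -⟩ := hT
  rw [hl.serious k hk ha, hidx j k hk]
  exact hw _

theorem IsBundleRun.isClassicalLoop (hf : LocallyLipschitz Q.f) (hx₁ : x₁ ∈ Q.C)
    (h : IsBundleRun P Q (standardModel Q.f) x₁ T)
    (hd : T.Reached j → StrictlyDifferentiableAt Q.f (T.x j)) : IsClassicalLoop P Q T j := by
  have hTR := h.isTrustRegionRun
  obtain ⟨hx0, -, G, hG⟩ := h
  exact (hG j).isClassicalLoop hf hd (hTR.mem (hx0 ▸ hx₁)) hTR.memory_pos

theorem isBundleRun_iff_isClassicalRun (hf : LocallyLipschitz Q.f) (hx₁ : x₁ ∈ Q.C)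
    (hd₁ : StrictlyDifferentiableAt Q.f x₁) {w : ℕ → Space n}
    (hw : ∀ i, StrictlyDifferentiableAt Q.f (w i)) (hT : T.DrawnFrom w) :
    IsBundleRun P Q (standardModel Q.f) x₁ T ↔ IsClassicalRun P Q x₁ T := by
  have hd : IsTrustRegionRun P Q T → T.x 0 = x₁ →
      ∀ j, T.Reached j → StrictlyDifferentiableAt Q.f (T.x j) := by
    rintro h h0 (_ | j) hj
    · rwa [h0]
    · exact h.strictlyDifferentiableAt_succ hw hT hj
  constructor
  · exact fun h => ⟨h.1, h.2.1, fun j =>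
      h.isClassicalLoop hf hx₁ (hd h.isTrustRegionRun h.1 j)⟩
  · exact fun h => ⟨h.1, h.2.1, _, fun j =>
      (h.2.2 j).isBundleLoop hf (hd h.isTrustRegionRun h.1 j)
        (h.isTrustRegionRun.mem (h.1.symm ▸ hx₁)) h.isTrustRegionRun.memory_pos⟩

end BundleTR

theorem mainTheorem6 {n : ℕ} (P : BundleTR.Params) (Q : BundleTR.Problem n)
    (hf : BundleTR.EssentiallySmooth Q.f)
    (x₁ : BundleTR.Space n) (hx₁ : x₁ ∈ Q.C)
    (hbdd : Bornology.IsBounded {x | x ∈ Q.C ∧ Q.f x ≤ Q.f x₁}) :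
    -- random trial steps: the bundle method is the classical method, with probability one
    (∀ {Ω : Type*} [MeasurableSpace Ω] (Pr : Measure Ω) [IsProbabilityMeasure Pr]
        (μ : Measure (BundleTR.Space n)) [IsProbabilityMeasure μ],
        μ ≪ volume → μ Q.Cᶜ = 0 →
        ∀ W : ℕ → Ω → BundleTR.Space n, (∀ i, Measurable (W i)) → iIndepFun W Pr →
        (∀ i, Pr.map (W i) = μ) →
        ∀ᵐ ω ∂Pr, ∀ T : BundleTR.Trace n, T.DrawnFrom (fun i => W i ω) →
          (BundleTR.IsBundleRun P Q (BundleTR.standardModel Q.f) x₁ T →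
            ∀ j, 1 ≤ j → BundleTR.IsClassicalLoop P Q T j) ∧
          (BundleTR.StrictlyDifferentiableAt Q.f x₁ →
            (BundleTR.IsBundleRun P Q (BundleTR.standardModel Q.f) x₁ T ↔
              BundleTR.IsClassicalRun P Q x₁ T))) ∧
    -- strict standard model: accumulation points of the serious iterates are critical
    ((∀ x ∈ Q.C, BundleTR.IsStrictModelAt Q.f (BundleTR.standardModel Q.f) x) →
      ∀ T : BundleTR.Trace n, BundleTR.IsBundleRun P Q (BundleTR.standardModel Q.f) x₁ T →
        (∀ j, T.Reached j) →
        ∀ xs : BundleTR.Space n, MapClusterPt xs atTop T.x → BundleTR.IsCritical Q.f Q.C xs) := by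
  refine ⟨?_, fun hstrict T hT hreach xs hxs =>
    BundleTR.isCritical_of_mapClusterPt hf.1 hx₁ hstrict hT hreach hxs⟩
  intro Ω _ Pr _ μ _ hμ _ W hW _ hlaw
  have h : ∀ᵐ ω ∂Pr, ∀ i, BundleTR.StrictlyDifferentiableAt Q.f (W i ω) := by
    refine ae_all_iff.2 fun i => ?_
    refine ae_of_ae_map (hW i).aemeasurable ?_
    rw [hlaw i]
    exact hμ.ae_le hf.2
  filter_upwards [h] with ω hω T hT
  refine ⟨fun hrun j hj => ?_, fun hd₁ =>
    BundleTR.isBundleRun_iff_isClassicalRun hf.1 hx₁ hd₁ hω hT⟩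
  obtain ⟨j, rfl⟩ := Nat.exists_eq_add_of_le' hj
  exact hrun.isClassicalLoop hf.1 hx₁
    (hrun.isTrustRegionRun.strictlyDifferentiableAt_succ hω hT)
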